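/- Let $X$ and $E$ be Banach spaces, each real or complex. Suppose that $X$ admits a strongly continuous linear isometric action $G\curvearrowright X$ (that is, $G$ acts by surjective linear isometries and $g\mapsto g(x)$ is continuous for every $x\in X$) of an amenable topological group $G$, and that some $G$-orbit of a point of the unit sphere $\mathsf S_X=\{x\in X:\|x\|=1\}$ is dense in $\mathsf S_X$. Here $G$ is amenable if there is a left-invariant mean on the space of bounded real functions $f$ on $G$ that are right uniformly continuous, i.e. $\sup_{x\in G}|f(ux)-f(x)|\to 0$ as $u\to 1$. Assume also that there is a uniformly continuous map $\phi:X\to E$ with $$\inf_{\|x-y\|=r}\|\phi(x)-\phi(y)\|>0\quad\text{for some } r>0 .$$ Then there are a Banach space $V$, over the same scalar field as $E$, and a map $f:X\to V$ such that 1. $V$ is finitely representable in $L^2(E)=L^2([0,1];E)$, the space of Bochner square-integrable functions: for every finite-dimensional subspace $F\subseteq V$ and every $\varepsilon>0$ there is a linear map $T:F\to L^2(E)$ with $\|v\|\leqslant\|Tv\|\leqslant(1+\varepsilon)\|v\|$ for all $v\in F$; 2. $f$ is a uniform embedding: for all sequences $x_n,y_n$ in $X$, $\lim_n\|x_n-y_n\|=0$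 if and only if $\lim_n\|f(x_n)-f(y_n)\|=0$; 3. $f$ is a coarse embedding: for all sequences $x_n,y_n$ in $X$, $\lim_n\|x_n-y_n\|=\infty$ if and only if $\lim_n\|f(x_n)-f(y_n)\|=\infty$. -/

import Mathlib

open Filter Topology MeasureTheory

universe u v w

/-- The space `RUCB(G)` of bounded right uniformly continuous functions `f : G → ℝ` on a topological
group `G`: those bounded `f` for which `f (u * x) - f x` tends to `0` uniformly in `x : G` as
`u → 1`. (Such functions are continuous, being uniformly continuous for the uniformity whose basic
entourages are the sets of all `(x, y)` with `y * x⁻¹ ∈ U`, for `U` a neighbourhood of `1`.) -/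
def RUCB (G : Type*) [Group G] [TopologicalSpace G] [IsTopologicalGroup G] :
    Submodule ℝ (G → ℝ) where
  carrier := {f | (∃ C : ℝ, ∀ x, |f x| ≤ C) ∧
    ∀ ε : ℝ, 0 < ε → ∀ᶠ u in 𝓝 (1 : G), ∀ x, |f (u * x) - f x| < ε}
  zero_mem' := by
    refine ⟨⟨0, fun x => by simp⟩, fun ε hε => Eventually.of_forall fun u x => by simpa using hε⟩
  add_mem' := by
    rintro f g ⟨⟨C, hC⟩, hf⟩ ⟨⟨D, hD⟩, hg⟩
    refine ⟨⟨C + D, fun x => (abs_add_le _ _).trans (add_le_add (hC x) (hD x))⟩, fun ε hε => ?_⟩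
    filter_upwards [hf (ε / 2) (half_pos hε), hg (ε / 2) (half_pos hε)] with u hu hv x
    have e : (f + g) (u * x) - (f + g) x = (f (u * x) - f x) + (g (u * x) - g x) := by
      simp only [Pi.add_apply]; ring
    rw [e]
    have h3 := abs_add_le (f (u * x) - f x) (g (u * x) - g x)
    linarith [hu x, hv x]
  smul_mem' := by
    rintro c f ⟨⟨C, hC⟩, hf⟩
    refine ⟨⟨|c| * C, fun x => ?_⟩, fun ε hε => ?_⟩
    · simp only [Pi.smul_apply, smul_eq_mul, abs_mul]
      exact mul_le_mul_of_nonneg_left (hC x) (abs_nonneg c)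
    · have hc : 0 < |c| + 1 := by positivity
      filter_upwards [hf (ε / (|c| + 1)) (by positivity)] with u hu x
      simp only [Pi.smul_apply, smul_eq_mul, ← mul_sub, abs_mul]
      have h1 := (lt_div_iff₀ hc).1 (hu x)
      nlinarith [abs_nonneg (f (u * x) - f x)]

/-- A topological group is amenable if `RUCB(G)` carries a left-invariant mean: a positive linear
functional with value `1` at the constant function `1` that is invariant under all the left
translations `f ↦ (x ↦ f (g * x))` (these map `RUCB(G)` to itself). -/
def IsAmenable (G : Type*) [Group G] [TopologicalSpace G] [IsTopologicalGroup G] : Prop :=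
  ∃ m : RUCB G →ₗ[ℝ] ℝ,
    (∀ f : RUCB G, (∀ x, 0 ≤ (f : G → ℝ) x) → 0 ≤ m f) ∧
    (∀ f : RUCB G, (∀ x, (f : G → ℝ) x = 1) → m f = 1) ∧
    ∀ (g : G) (f f' : RUCB G), (∀ x, (f' : G → ℝ) x = (f : G → ℝ) (g * x)) → m f' = m f

/-- `V` is finitely representable in `W`: every finite-dimensional subspace `F` of `V` is, for every
`ε > 0`, linearly `(1 + ε)`-isomorphic to a subspace of `W`. -/
def FinitelyRepresentable (𝕜 V W : Type*) [RCLike 𝕜] [NormedAddCommGroup V] [NormedSpace 𝕜 V]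
    [NormedAddCommGroup W] [NormedSpace 𝕜 W] : Prop :=
  ∀ F : Submodule 𝕜 V, FiniteDimensional 𝕜 F → ∀ ε : ℝ, 0 < ε →
    ∃ T : F →ₗ[𝕜] W, ∀ v : F, ‖v‖ ≤ ‖T v‖ ∧ ‖T v‖ ≤ (1 + ε) * ‖v‖

/-- `f` is a coarse embedding: `‖xₙ - yₙ‖ → ∞` if and only if `‖f xₙ - f yₙ‖ → ∞`, for all
sequences `xₙ`, `yₙ`. -/
def IsCoarseEmbedding {X V : Type*} [NormedAddCommGroup X] [NormedAddCommGroup V]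
    (f : X → V) : Prop :=
  ∀ x y : ℕ → X, Tendsto (fun n => ‖x n - y n‖) atTop atTop ↔
    Tendsto (fun n => ‖f (x n) - f (y n)‖) atTop atTop

/-!
The map `f` is built from `φ` by averaging. For `g : G` and `z : X` let `T g z` be the linear
extension to `X →₀ 𝕂` of `x ↦ φ (g⁻¹ • x + z) - φ z`, and let `Q ξ` be the mean of `‖T g z ξ‖ ^ 2`
over `z`, for an invariant mean on the abelian group `X`, and then over `g`, for the given mean on
`G`. Then `Q (δ_x - δ_y)` is invariant under the translations and under `G`; as the orbits are
dense in the spheres, it equals `k ‖x - y‖` for a function `k` (`exists_invariant_kernel`).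
Uniform continuity of `φ` makes `k` vanish continuously at `0`, and `k r > 0` by hypothesis.
Summing suitable rescalings gives the same with an unbounded `k` (`exists_unbounded_kernel`).

All these operations preserve the closed convex cone generated by the functions `ξ ↦ ‖T ξ‖ ^ 2`
with `T : (X →₀ 𝕂) → E` linear. It is handled through its dual description, by linear inequalities
(`InSquareCone`). Every member `Q` of the cone is the square of a seminorm, and by the separation
theorem it is approximated on finite sets by finite sums of functions `‖T ξ‖ ^ 2`, that is, by
squared norms of linear maps into `L²([0, 1]; E)`. So the completion `V` of `X →₀ 𝕂` for `√Q` is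
finitely representable in `L²(E)` (`InSquareCone.finitelyRepresentable`).

The map `f x = δ_x` satisfies `‖f x - f y‖ = D ‖x - y‖` with `D = √k`. If `X` has real dimension
at least two, an isosceles triangle with two sides `t` and third side `s` exists for all `s ≤ 2 *
t`, so `D s ≤ 2 * D t`. Together with `D t → 0` as `t → 0` and the unboundedness of `D`, this
alone implies that `f` is a uniform and coarse embedding
(`isUniformEmbedding_and_isCoarseEmbedding`). In real dimension one, where spheres are
disconnected, `X` is the real line and embeds isometrically into the scalar field `𝕂`, hence into
`L²(E)`.
-/

/-! ### The closed cone of squared norms -/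

/-- `Q : W → ℝ` lies in the closed convex cone generated by the functions `w ↦ ‖T w‖ ^ 2`, where
`T` ranges over all linear maps `W → E` and `W → ℝ` carries the topology of pointwise convergence.
By the bipolar theorem, membership means that `Q` satisfies every finite linear inequality
satisfied by all the functions `w ↦ ‖T w‖ ^ 2`, and this is what the definition says: in this
form, stability under sums, limits and means is immediate. -/
def InSquareCone (𝕂 E : Type*) {W : Type*} [RCLike 𝕂] [NormedAddCommGroup E] [NormedSpace 𝕂 E]
    [AddCommGroup W] [Module 𝕂 W] (Q : W → ℝ) : Prop :=
  ∀ (n : ℕ) (p : Fin n → W) (a : Fin n → ℝ),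
    (∀ T : W →ₗ[𝕂] E, 0 ≤ ∑ i, a i * ‖T (p i)‖ ^ 2) → 0 ≤ ∑ i, a i * Q (p i)

namespace InSquareCone

variable {𝕂 E W W' : Type*} [RCLike 𝕂] [NormedAddCommGroup E] [NormedSpace 𝕂 E]
  [AddCommGroup W] [Module 𝕂 W] [AddCommGroup W'] [Module 𝕂 W'] {Q : W → ℝ}

theorem of_linearMap (T : W →ₗ[𝕂] E) : InSquareCone 𝕂 E fun w => ‖T w‖ ^ 2 :=
  fun _ _ _ h => h T

theorem comp (hQ : InSquareCone 𝕂 E Q) (L : W' →ₗ[𝕂] W) : InSquareCone 𝕂 E fun w => Q (L w) :=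
  fun n p a h => hQ n (fun i => L (p i)) a fun T => h (T ∘ₗ L)

theorem const_mul (hQ : InSquareCone 𝕂 E Q) {b : ℝ} (hb : 0 ≤ b) :
    InSquareCone 𝕂 E fun w => b * Q w := by
  intro n p a h
  have := mul_nonneg hb (hQ n p a h)
  rw [Finset.mul_sum] at this
  simpa only [mul_left_comm] using this

theorem of_hasSum {q : ℕ → W → ℝ} (hq : ∀ n, InSquareCone 𝕂 E (q n))
    (hs : ∀ w, HasSum (fun n => q n w) (Q w)) : InSquareCone 𝕂 E Q := by
  intro n p a h
  exact (hasSum_sum fun i _ => (hs (p i)).mul_left (a i)).nonneg fun k => hq k n p a h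

/-- The cone is stable under integration against positive linear functionals. -/
theorem of_positive {Y : Type*} {S : Submodule ℝ (Y → ℝ)} (m : S →ₗ[ℝ] ℝ)
    (hm : ∀ f : S, (∀ y, 0 ≤ (f : Y → ℝ) y) → 0 ≤ m f) {q : Y → W → ℝ}
    (hq : ∀ y, InSquareCone 𝕂 E (q y)) (hS : ∀ w, (fun y => q y w) ∈ S) :
    InSquareCone 𝕂 E fun w => m ⟨fun y => q y w, hS w⟩ := by
  intro n p a h
  have h1 : ∑ i, a i * m ⟨fun y => q y (p i), hS (p i)⟩ =
      m (∑ i, a i • ⟨fun y => q y (p i), hS (p i)⟩) := by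
    rw [_root_.map_sum]
    exact Finset.sum_congr rfl fun i _ => by rw [_root_.map_smul, smul_eq_mul]
  rw [h1]
  refine hm _ fun y => ?_
  have h2 := hq y n p a h
  simpa [Finset.sum_apply] using h2

theorem nonneg (hQ : InSquareCone 𝕂 E Q) (w : W) : 0 ≤ Q w := by
  simpa using hQ 1 ![w] ![1] fun T => by simp

theorem map_smul (hQ : InSquareCone 𝕂 E Q) (c : 𝕂) (w : W) : Q (c • w) = ‖c‖ ^ 2 * Q w := by
  have h1 := hQ 2 ![c • w, w] ![1, -‖c‖ ^ 2] fun T => by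
    simp [Fin.sum_univ_two, norm_smul, mul_pow]
  have h2 := hQ 2 ![c • w, w] ![-1, ‖c‖ ^ 2] fun T => by
    simp [Fin.sum_univ_two, norm_smul, mul_pow]
  simp [Fin.sum_univ_two] at h1 h2
  linarith

theorem map_add_le (hQ : InSquareCone 𝕂 E Q) (v w : W) {t : ℝ} (ht : 0 < t) :
    Q (v + w) ≤ (1 + t) * Q v + (1 + t⁻¹) * Q w := by
  have h := hQ 3 ![v + w, v, w] ![-1, 1 + t, 1 + t⁻¹] fun T => by
    have h1 : ‖T v + T w‖ ^ 2 ≤ (‖T v‖ + ‖T w‖) ^ 2 := by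
      gcongr; exact norm_add_le _ _
    have h2 : 2 * (‖T v‖ * ‖T w‖) ≤ t * ‖T v‖ ^ 2 + t⁻¹ * ‖T w‖ ^ 2 := by
      have h3 : 0 ≤ t⁻¹ * (t * ‖T v‖ - ‖T w‖) ^ 2 := by positivity
      have h4 : t⁻¹ * (t * ‖T v‖ - ‖T w‖) ^ 2 =
          t * ‖T v‖ ^ 2 + t⁻¹ * ‖T w‖ ^ 2 - 2 * (‖T v‖ * ‖T w‖) := by
        field_simp
        ring
      linarith
    simp [Fin.sum_univ_three]
    nlinarith
  simp [Fin.sum_univ_three] at h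
  linarith

/-- The triangle inequality for `√Q`: it follows from the family of linear inequalities
`map_add_le`, by optimizing the parameter. -/
theorem sqrt_add_le (hQ : InSquareCone 𝕂 E Q) (v w : W) :
    √(Q (v + w)) ≤ √(Q v) + √(Q w) := by
  have ha := Real.sq_sqrt (hQ.nonneg v)
  have hb := Real.sq_sqrt (hQ.nonneg w)
  have ha0 := Real.sqrt_nonneg (Q v)
  have hb0 := Real.sqrt_nonneg (Q w)
  set a := √(Q v)
  set b := √(Q w)
  refine le_of_forall_pos_le_add fun ε hε => ?_
  have h := hQ.map_add_le v w (t := (b + ε / 2) / (a + ε / 2)) (by positivity)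
  rw [← ha, ← hb] at h
  refine Real.sqrt_le_iff.2 ⟨by positivity, h.trans ?_⟩
  have h1 : (1 + (b + ε / 2) / (a + ε / 2)) * a ^ 2 ≤
      (1 + (b + ε / 2) / (a + ε / 2)) * (a + ε / 2) ^ 2 := by
    gcongr; linarith
  have h2 : (1 + ((b + ε / 2) / (a + ε / 2))⁻¹) * b ^ 2 ≤
      (1 + ((b + ε / 2) / (a + ε / 2))⁻¹) * (b + ε / 2) ^ 2 := by
    gcongr; linarith
  have h3 : (1 + (b + ε / 2) / (a + ε / 2)) * (a + ε / 2) ^ 2 +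
      (1 + ((b + ε / 2) / (a + ε / 2))⁻¹) * (b + ε / 2) ^ 2 = (a + b + ε) ^ 2 := by
    field_simp
    ring
  linarith

theorem map_zero (hQ : InSquareCone 𝕂 E Q) : Q 0 = 0 := by
  simpa using hQ.map_smul 0 0

theorem map_neg (hQ : InSquareCone 𝕂 E Q) (w : W) : Q (-w) = Q w := by
  simpa using hQ.map_smul (-1) w

/-- The seminormed group structure on `W` given by `√Q`. -/
@[reducible] noncomputable def seminormedAddCommGroup (hQ : InSquareCone 𝕂 E Q) :
    SeminormedAddCommGroup W :=
  AddGroupSeminorm.toSeminormedAddCommGroup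
    { toFun := fun w => √(Q w)
      map_zero' := by simp [hQ.map_zero]
      add_le' := hQ.sqrt_add_le
      neg' := fun w => by simp [hQ.map_neg] }

end InSquareCone

/-! ### Finite square sums inside `L²([0, 1]; E)` -/

/-- Finitely many maps into `E` are glued into one map into `L²([0, 1]; E)` by placing them,
suitably rescaled, on disjoint intervals. -/
theorem exists_linearMap_L2 {𝕂 E W : Type*} [RCLike 𝕂] [NormedAddCommGroup E] [NormedSpace 𝕂 E]
    [AddCommGroup W] [Module 𝕂 W] {n : ℕ} (T : Fin n → W →ₗ[𝕂] E) :
    ∃ S : W →ₗ[𝕂] Lp E 2 (volume.restrict (Set.Icc (0 : ℝ) 1)),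
      ∀ w, ‖S w‖ ^ 2 = ∑ j, ‖T j w‖ ^ 2 := by
  set μ := volume.restrict (Set.Icc (0 : ℝ) 1) with hμ
  let A : ℕ → Set ℝ := fun j => Set.Ico ((j : ℝ) / n) ((j + 1 : ℕ) / n)
  have hA : ∀ j, MeasurableSet (A j) := fun j => measurableSet_Ico
  have hAd : Pairwise (Function.onFun Disjoint A) := by
    have hm : Monotone fun j : ℕ => (j : ℝ) / n := fun i j hij => by
      have : (i : ℝ) ≤ j := by exact_mod_cast hij
      dsimp only
      gcongr
    exact hm.pairwise_disjoint_on_Ico_succ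
  have hAμ : ∀ j : Fin n, μ.real (A j) = (n : ℝ)⁻¹ := by
    intro j
    have hn : (0 : ℝ) < n := by exact_mod_cast j.pos
    have hj : ((j : ℕ) : ℝ) + 1 ≤ n := by exact_mod_cast j.isLt
    have hsub : A j ⊆ Set.Icc 0 1 := by
      intro t ht
      refine ⟨le_trans (by positivity) ht.1, ht.2.le.trans ?_⟩
      rw [div_le_one hn]
      exact_mod_cast hj
    have hlen : ((j + 1 : ℕ) : ℝ) / n - (j : ℕ) / n = (n : ℝ)⁻¹ := by push_cast; ring
    rw [measureReal_def, hμ, Measure.restrict_apply (hA j), Set.inter_eq_left.2 hsub,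
      Real.volume_Ico, hlen, ENNReal.toReal_ofReal (by positivity)]
  let F : W → ℝ → E := fun w t => ∑ j : Fin n, (A j).indicator (fun _ => ((√n : ℝ) : 𝕂) • T j w) t
  have hF : ∀ w, MemLp (F w) 2 μ := fun w =>
    memLp_finsetSum _ fun j _ => memLp_indicator_const _ (hA j) _ (Or.inr (measure_ne_top _ _))
  have hnorm : ∀ w t, ‖F w t‖ ^ 2 =
      ∑ j : Fin n, (A j).indicator (fun _ => (n : ℝ) * ‖T j w‖ ^ 2) t := by
    intro w t
    by_cases h : ∃ j : Fin n, t ∈ A j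
    · obtain ⟨j, hj⟩ := h
      have hne : ∀ i : Fin n, i ≠ j → t ∉ A i := fun i hi hti =>
        Set.disjoint_left.1 (hAd (fun h => hi (Fin.ext h))) hti hj
      dsimp only [F]
      rw [Finset.sum_eq_single j (fun i _ hi => Set.indicator_of_notMem (hne i hi) _) (by simp),
        Finset.sum_eq_single j (fun i _ hi => Set.indicator_of_notMem (hne i hi) _) (by simp),
        Set.indicator_of_mem hj, Set.indicator_of_mem hj, norm_smul, mul_pow, RCLike.norm_ofReal,
        sq_abs, Real.sq_sqrt (Nat.cast_nonneg n)]
    · push Not at h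
      dsimp only [F]
      rw [Finset.sum_eq_zero fun i _ => Set.indicator_of_notMem (h i) _,
        Finset.sum_eq_zero fun i _ => Set.indicator_of_notMem (h i) _]
      simp
  refine ⟨{ toFun := fun w => (hF w).toLp, map_add' := ?_, map_smul' := ?_ }, ?_⟩
  · intro v w
    rw [← MemLp.toLp_add]
    congr 1
    ext t
    simp only [F, Pi.add_apply, ← Finset.sum_add_distrib, map_add, smul_add]
    exact Finset.sum_congr rfl fun j _ => by
      by_cases h : t ∈ A j <;> simp [h]
  · intro c w
    rw [RingHom.id_apply, ← MemLp.toLp_const_smul]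
    congr 1
    ext t
    simp only [F, Pi.smul_apply, Finset.smul_sum, map_smul]
    exact Finset.sum_congr rfl fun j _ => by
      rw [← Set.indicator_const_smul_apply, smul_comm]
  · intro w
    have h0 : 0 ≤ ∫ t, ‖F w t‖ ^ 2 ∂μ := integral_nonneg fun t => by positivity
    have h1 : ‖(hF w).toLp‖ ^ 2 = ∫ t, ‖F w t‖ ^ 2 ∂μ := by
      rw [Lp.norm_toLp, (hF w).eLpNorm_eq_integral_rpow_norm (by simp) (by simp),
        ENNReal.toReal_ofReal (by positivity)]
      simp only [ENNReal.toReal_ofNat, Real.rpow_two]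
      rw [← Real.rpow_natCast, ← Real.rpow_mul h0]
      norm_num
    change ‖(hF w).toLp‖ ^ 2 = _
    rw [h1]
    simp_rw [hnorm]
    rw [integral_finsetSum]
    · refine Finset.sum_congr rfl fun j _ => ?_
      have hn : (n : ℝ) ≠ 0 := by exact_mod_cast j.pos.ne'
      rw [integral_indicator_const _ (hA j), hAμ j, smul_eq_mul, inv_mul_cancel_left₀ hn]
    · intro j _
      exact (integrable_const _).indicator (hA j)

/-! ### Finite representability of the completion -/

/-- On finitely many vectors, a member of the closed cone is approximated by the squared norm of a
single linear map into `L²([0, 1]; E)`: this is the separation theorem in `ℝ ^ N`. -/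
theorem InSquareCone.exists_linearMap_approx {𝕂 E W : Type*} [RCLike 𝕂] [NormedAddCommGroup E]
    [NormedSpace 𝕂 E] [AddCommGroup W] [Module 𝕂 W] {Q : W → ℝ} (hQ : InSquareCone 𝕂 E Q)
    {N : ℕ} (p : Fin N → W) {η : ℝ} (hη : 0 < η) :
    ∃ S : W →ₗ[𝕂] Lp E 2 (volume.restrict (Set.Icc (0 : ℝ) 1)),
      ∀ i, |‖S (p i)‖ ^ 2 - Q (p i)| < η := by
  let C : Set (Fin N → ℝ) := {y | ∃ (n : ℕ) (T : Fin n → W →ₗ[𝕂] E),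
    y = fun i => ∑ j, ‖T j (p i)‖ ^ 2}
  have hsmul : ∀ y ∈ C, ∀ b : ℝ, 0 ≤ b → b • y ∈ C := by
    rintro _ ⟨n, T, rfl⟩ b hb
    refine ⟨n, fun j => ((√b : ℝ) : 𝕂) • T j, ?_⟩
    ext i
    simp [norm_smul, mul_pow, Real.sq_sqrt hb, Finset.mul_sum]
  have hadd : ∀ y ∈ C, ∀ z ∈ C, y + z ∈ C := by
    rintro _ ⟨n, T, rfl⟩ _ ⟨m, T', rfl⟩
    refine ⟨n + m, Fin.append T T', ?_⟩
    ext i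
    simp [Fin.sum_univ_add]
  have hconv : Convex ℝ C := fun y hy z hz a b ha hb _ =>
    hadd _ (hsmul y hy a ha) _ (hsmul z hz b hb)
  have hmem : (fun i => Q (p i)) ∈ closure C := by
    by_contra hnot
    obtain ⟨f, s, hfs, hs⟩ :=
      geometric_hahn_banach_point_closed hconv.closure isClosed_closure hnot
    have h0 : (0 : Fin N → ℝ) ∈ C := ⟨0, Fin.elim0, by ext; simp⟩
    have hs0 : s < 0 := by simpa using hs 0 (subset_closure h0)
    have hrep : ∀ y, f y = ∑ i, f (Pi.single i 1) * y i := by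
      intro y
      conv_lhs => rw [pi_eq_sum_univ' y]
      rw [map_sum]
      exact Finset.sum_congr rfl fun i _ => by
        rw [_root_.map_smul, smul_eq_mul, mul_comm]
    have hpos : ∀ y ∈ C, 0 ≤ f y := by
      intro y hy
      by_contra hneg
      push Not at hneg
      have h1 := hs _ (subset_closure (hsmul y hy (s / f y)
        (div_nonneg_of_nonpos hs0.le hneg.le)))
      rw [_root_.map_smul, smul_eq_mul, div_mul_cancel₀ _ hneg.ne] at h1
      exact lt_irrefl _ h1
    have h2 := hQ N p (fun i => f (Pi.single i 1)) fun T => by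
      have h3 := hpos (fun i => ‖T (p i)‖ ^ 2) ⟨1, fun _ => T, by simp⟩
      rwa [hrep] at h3
    rw [← hrep fun i => Q (p i)] at h2
    linarith
  obtain ⟨y, ⟨n, T, rfl⟩, hy⟩ := Metric.mem_closure_iff.1 hmem η hη
  obtain ⟨S, hS⟩ := exists_linearMap_L2 T
  refine ⟨S, fun i => ?_⟩
  rw [hS]
  have h := (dist_pi_lt_iff hη).1 hy i
  rwa [Real.dist_eq, abs_sub_comm] at h

/-- A finite-dimensional subspace of the completion of `W` is the image of a small perturbation of
the inclusion by a map that factors through `W`. -/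
theorem exists_linearMap_near_inclusion {𝕂 W : Type*} [RCLike 𝕂] [SeminormedAddCommGroup W]
    [NormedSpace 𝕂 W] (F : Submodule 𝕂 (UniformSpace.Completion W)) [FiniteDimensional 𝕂 F]
    {η : ℝ} (hη : 0 < η) :
    ∃ j : F →ₗ[𝕂] W, ∀ v : F, |‖j v‖ - ‖v‖| ≤ η * ‖v‖ := by
  let b := Module.finBasis 𝕂 F
  let φ : Fin (Module.finrank 𝕂 F) → F →L[𝕂] 𝕂 := fun i =>
    LinearMap.toContinuousLinearMap (b.coord i)
  set C := ∑ i, ‖φ i‖ with hC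
  have hC0 : 0 ≤ C := by positivity
  have hw : ∀ i, ∃ w : W, ‖(w : UniformSpace.Completion W) - b i‖ ≤ η / (C + 1) := by
    intro i
    obtain ⟨w, hw⟩ := (UniformSpace.Completion.denseRange_coe (α := W)).exists_dist_lt
      (b i : UniformSpace.Completion W) (ε := η / (C + 1)) (by positivity)
    exact ⟨w, by rw [← dist_eq_norm, dist_comm]; exact hw.le⟩
  choose w hw using hw
  refine ⟨b.constr 𝕂 w, fun v => ?_⟩
  have hv : (v : UniformSpace.Completion W) =
      ∑ i, b.repr v i • (b i : UniformSpace.Completion W) := by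
    have h := congrArg F.subtype (b.sum_repr v).symm
    simpa only [map_sum, map_smul, Submodule.subtype_apply] using h
  have hj : ((b.constr 𝕂 w v : W) : UniformSpace.Completion W) =
      ∑ i, b.repr v i • (w i : UniformSpace.Completion W) := by
    have h := congrArg (UniformSpace.Completion.toComplL (𝕜 := 𝕂) (E := W))
      (b.constr_apply_fintype 𝕂 w v)
    simpa only [map_sum, map_smul, UniformSpace.Completion.coe_toComplL,
      Module.Basis.equivFun_apply] using h
  have h1 : ‖((b.constr 𝕂 w v : W) : UniformSpace.Completion W) - v‖ ≤ η * ‖v‖ := by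
    rw [hj, hv, ← Finset.sum_sub_distrib]
    calc ‖∑ i, (b.repr v i • (w i : UniformSpace.Completion W) -
            b.repr v i • (b i : UniformSpace.Completion W))‖
        ≤ ∑ i, ‖φ i‖ * ‖v‖ * (η / (C + 1)) := by
          refine norm_sum_le_of_le _ fun i _ => ?_
          rw [← smul_sub, norm_smul]
          exact mul_le_mul ((φ i).le_opNorm v) (hw i) (norm_nonneg _) (by positivity)
      _ = η * ‖v‖ * (C / (C + 1)) := by
          rw [← Finset.sum_mul, ← Finset.sum_mul]; ring
      _ ≤ η * ‖v‖ * 1 := by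
          gcongr
          rw [div_le_one (by positivity)]
          linarith
      _ = η * ‖v‖ := mul_one _
  have h2 := abs_norm_sub_norm_le ((b.constr 𝕂 w v : W) : UniformSpace.Completion W) v
  rw [UniformSpace.Completion.norm_coe] at h2
  exact h2.trans h1

theorem InSquareCone.finitelyRepresentable {𝕂 E W : Type*} [RCLike 𝕂] [NormedAddCommGroup E]
    [NormedSpace 𝕂 E] [SeminormedAddCommGroup W] [NormedSpace 𝕂 W]
    (hQ : InSquareCone 𝕂 E fun w : W => ‖w‖ ^ 2) :
    FinitelyRepresentable 𝕂 (UniformSpace.Completion W)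
      (Lp E 2 (volume.restrict (Set.Icc (0 : ℝ) 1))) := by
  intro F hF ε hε
  -- `η` is the solution of `1 + 5 * η = (1 + ε) * (1 - 6 * η)`.
  set η := ε / (11 + 6 * ε) with hη
  have hη0 : 0 < η := by positivity
  have hη1 : η < 1 / 6 := by
    rw [hη, div_lt_iff₀ (by positivity)]; linarith
  have hηε : 1 + 5 * η = (1 + ε) * (1 - 6 * η) := by
    rw [hη]; field_simp; ring
  obtain ⟨j, hj⟩ := exists_linearMap_near_inclusion F hη0
  have : ProperSpace F := FiniteDimensional.proper 𝕂 F
  obtain ⟨s, hs, hsf, hcov⟩ := (isCompact_sphere (0 : F) 1).finite_cover_balls hη0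
  let p : Fin hsf.toFinset.card → F := fun i => (hsf.toFinset.equivFin.symm i : F)
  obtain ⟨S, hS⟩ := hQ.exists_linearMap_approx (fun i => j (p i)) hη0
  have hS' : ∀ v ∈ s, |‖S (j v)‖ ^ 2 - ‖j v‖ ^ 2| < η := by
    intro v hv
    have := hS (hsf.toFinset.equivFin ⟨v, hsf.mem_toFinset.2 hv⟩)
    simpa [p] using this
  let U : F →L[𝕂] Lp E 2 (volume.restrict (Set.Icc (0 : ℝ) 1)) :=
    LinearMap.toContinuousLinearMap (S ∘ₗ j)
  have hUs : ∀ v ∈ s, 1 - 4 * η ≤ ‖U v‖ ∧ ‖U v‖ ≤ 1 + 3 * η := by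
    intro v hv
    have h1 : ‖v‖ = 1 := by simpa using hs hv
    have h2 := hj v
    have h3 := hS' v hv
    change 1 - 4 * η ≤ ‖S (j v)‖ ∧ ‖S (j v)‖ ≤ 1 + 3 * η
    rw [h1, mul_one] at h2
    obtain ⟨h4, h5⟩ := abs_le.1 h2
    obtain ⟨h6, h7⟩ := abs_lt.1 h3
    have h8 : (1 - η) ^ 2 ≤ ‖j v‖ ^ 2 := by gcongr <;> linarith
    have h9 : ‖j v‖ ^ 2 ≤ (1 + η) ^ 2 := by gcongr; linarith
    constructor
    · exact le_of_sq_le_sq (by nlinarith) (norm_nonneg _)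
    · exact le_of_sq_le_sq (by nlinarith) (by positivity)
  -- Every vector is close to a multiple of a point of the net `s`.
  have hnet : ∀ v : F, v ≠ 0 → ∃ x ∈ s, |‖U v‖ - ‖v‖ * ‖U x‖| ≤ ‖U‖ * η * ‖v‖ := by
    intro v hv
    have hv0 : 0 < ‖v‖ := norm_pos_iff.2 hv
    have hmem : ((‖v‖⁻¹ : ℝ) : 𝕂) • v ∈ Metric.sphere (0 : F) 1 := by
      rw [mem_sphere_zero_iff_norm, norm_smul, RCLike.norm_ofReal,
        abs_of_pos (inv_pos.2 hv0), inv_mul_cancel₀ hv0.ne']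
    obtain ⟨x, hx, hxv⟩ := Set.mem_iUnion₂.1 (hcov hmem)
    refine ⟨x, hx, ?_⟩
    rw [Metric.mem_ball, dist_eq_norm] at hxv
    have h1 : v - ((‖v‖ : ℝ) : 𝕂) • x =
        ((‖v‖ : ℝ) : 𝕂) • (((‖v‖⁻¹ : ℝ) : 𝕂) • v - x) := by
      rw [smul_sub, smul_smul, ← RCLike.ofReal_mul, mul_inv_cancel₀ hv0.ne']
      simp
    have h2 : ‖v - ((‖v‖ : ℝ) : 𝕂) • x‖ ≤ ‖v‖ * η := by
      rw [h1, norm_smul, RCLike.norm_ofReal, abs_of_nonneg hv0.le]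
      gcongr
    have h3 := abs_norm_sub_norm_le (U v) (U (((‖v‖ : ℝ) : 𝕂) • x))
    rw [← map_sub] at h3
    have h4 : ‖U (((‖v‖ : ℝ) : 𝕂) • x)‖ = ‖v‖ * ‖U x‖ := by
      rw [_root_.map_smul, norm_smul, RCLike.norm_ofReal, abs_of_nonneg hv0.le]
    rw [h4] at h3
    refine h3.trans ((U.le_opNorm _).trans ?_)
    calc ‖U‖ * ‖v - ((‖v‖ : ℝ) : 𝕂) • x‖ ≤ ‖U‖ * (‖v‖ * η) := by gcongr
      _ = ‖U‖ * η * ‖v‖ := by ring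
  have hU : ‖U‖ ≤ 2 := by
    have h1 : ‖U‖ ≤ 1 + 3 * η + ‖U‖ * η := by
      refine U.opNorm_le_bound (by positivity) fun v => ?_
      rcases eq_or_ne v 0 with rfl | hv
      · simp
      obtain ⟨x, hx, hxv⟩ := hnet v hv
      have h2 := (abs_le.1 hxv).2
      have h3 := mul_le_mul_of_nonneg_left (hUs x hx).2 (norm_nonneg v)
      linarith
    nlinarith [norm_nonneg U]
  have hpos : 0 < 1 - 6 * η := by linarith
  have hbound : ∀ v : F, (1 - 6 * η) * ‖v‖ ≤ ‖U v‖ ∧ ‖U v‖ ≤ (1 + 5 * η) * ‖v‖ := by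
    intro v
    rcases eq_or_ne v 0 with rfl | hv
    · simp
    obtain ⟨x, hx, hxv⟩ := hnet v hv
    obtain ⟨h2, h3⟩ := abs_le.1 hxv
    have h4 := mul_le_mul_of_nonneg_left (hUs x hx).1 (norm_nonneg v)
    have h5 := mul_le_mul_of_nonneg_left (hUs x hx).2 (norm_nonneg v)
    have h6 : ‖U‖ * η * ‖v‖ ≤ 2 * η * ‖v‖ := by gcongr
    constructor <;> linarith
  refine ⟨(((1 - 6 * η)⁻¹ : ℝ) : 𝕂) • (S ∘ₗ j), fun v => ?_⟩
  have hT : ‖((((1 - 6 * η)⁻¹ : ℝ) : 𝕂) • (S ∘ₗ j)) v‖ = (1 - 6 * η)⁻¹ * ‖U v‖ := by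
    rw [LinearMap.smul_apply, norm_smul, RCLike.norm_ofReal, abs_of_pos (inv_pos.2 hpos)]
    rfl
  rw [hT, inv_mul_eq_div, le_div_iff₀ hpos, div_le_iff₀ hpos]
  obtain ⟨h1, h2⟩ := hbound v
  constructor
  · linarith
  · rw [hηε] at h2; linarith

/-! ### Invariant means on abelian groups -/

/-- The space of bounded real functions on a set. -/
def boundedFunctions (Y : Type*) : Submodule ℝ (Y → ℝ) where
  carrier := {f | ∃ C : ℝ, ∀ x, |f x| ≤ C}
  zero_mem' := ⟨0, fun x => by simp⟩
  add_mem' := by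
    rintro f g ⟨C, hC⟩ ⟨D, hD⟩
    exact ⟨C + D, fun x => (abs_add_le _ _).trans (add_le_add (hC x) (hD x))⟩
  smul_mem' := by
    rintro c f ⟨C, hC⟩
    refine ⟨|c| * C, fun x => ?_⟩
    simp only [Pi.smul_apply, smul_eq_mul, abs_mul]
    exact mul_le_mul_of_nonneg_left (hC x) (abs_nonneg c)

/-- A positive normalized functional on a space of bounded functions containing the constants is
bounded by the supremum norm. -/
theorem abs_le_of_positive {Y : Type*} {S : Submodule ℝ (Y → ℝ)} (m : S →ₗ[ℝ] ℝ)
    (hm : ∀ f : S, (∀ y, 0 ≤ (f : Y → ℝ) y) → 0 ≤ m f)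
    (hone : ∀ f : S, (∀ y, (f : Y → ℝ) y = 1) → m f = 1) (h1 : (fun _ => 1 : Y → ℝ) ∈ S)
    (f : S) {C : ℝ} (hC : ∀ y, |(f : Y → ℝ) y| ≤ C) : |m f| ≤ C := by
  have e : m ⟨fun _ => 1, h1⟩ = 1 := hone _ fun _ => rfl
  rw [abs_le]
  constructor
  · have h := hm (f + C • ⟨fun _ => 1, h1⟩) fun y => by
      have := (abs_le.1 (hC y)).1
      simp only [Submodule.coe_add, Submodule.coe_smul, Pi.add_apply, Pi.smul_apply, smul_eq_mul]
      linarith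
    rw [map_add, map_smul, e, smul_eq_mul] at h
    linarith
  · have h := hm (C • ⟨fun _ => 1, h1⟩ - f) fun y => by
      have := (abs_le.1 (hC y)).2
      simp only [Submodule.coe_sub, Submodule.coe_smul, Pi.sub_apply, Pi.smul_apply, smul_eq_mul]
      linarith
    rw [map_sub, map_smul, e, smul_eq_mul] at h
    linarith

/-- Almost invariant means: iterating the averages over the segments `{0, s, …, n • s}`, for `s`
in a finite set, makes a point evaluation almost invariant under the translations by all these
`s`. -/
theorem exists_almost_invariant_mean {X : Type*} [AddCommGroup X] (S : Finset X) (n : ℕ) :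
    ∃ A : (X → ℝ) →ₗ[ℝ] ℝ, (∀ f C, (∀ x, |f x| ≤ C) → |A f| ≤ C) ∧ (∀ f, (∀ x, 0 ≤ f x) → 0 ≤ A f) ∧
      A (fun _ => 1) = 1 ∧
      ∀ w ∈ S, ∀ f C, (∀ x, |f x| ≤ C) → |A (fun x => f (x + w)) - A f| ≤ 2 * C / (n + 1) := by
  classical
  induction S using Finset.induction_on with
  | empty => exact ⟨LinearMap.proj 0, fun f C h => h 0, fun f h => h 0, rfl, by simp⟩
  | insert s S _ ih =>
    obtain ⟨A, hAb, hA0, hA1, hAS⟩ := ih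
    let B : (X → ℝ) →ₗ[ℝ] (X → ℝ) :=
      { toFun := fun f x => ((n : ℝ) + 1)⁻¹ * ∑ i ∈ Finset.range (n + 1), f (x + i • s)
        map_add' := fun f g => by
          ext x; simp only [Pi.add_apply, Finset.sum_add_distrib, mul_add]
        map_smul' := fun c f => by
          ext x
          simp only [Pi.smul_apply, smul_eq_mul, ← Finset.mul_sum, RingHom.id_apply]
          ring }
    have hB : ∀ f x, B f x = ((n : ℝ) + 1)⁻¹ * ∑ i ∈ Finset.range (n + 1), f (x + i • s) :=
      fun _ _ => rfl
    have hn : (0 : ℝ) < n + 1 := by positivity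
    have hBb : ∀ f C, (∀ x, |f x| ≤ C) → ∀ x, |B f x| ≤ C := by
      intro f C h x
      rw [hB, abs_mul, abs_of_pos (inv_pos.2 hn), inv_mul_le_iff₀ hn]
      refine (Finset.abs_sum_le_sum_abs _ _).trans ((Finset.sum_le_card_nsmul _ _ C
        fun i _ => h _).trans ?_)
      simp
    refine ⟨A ∘ₗ B, fun f C h => hAb _ _ (hBb f C h), fun f h => hA0 _ fun x => ?_, ?_, ?_⟩
    · rw [hB]
      exact mul_nonneg (inv_nonneg.2 hn.le) (Finset.sum_nonneg fun i _ => h _)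
    · have : B (fun _ => 1) = fun _ => 1 := by
        ext x
        rw [hB]
        simp [hn.ne']
      rw [LinearMap.comp_apply, this, hA1]
    · intro w hw f C hC
      rw [LinearMap.comp_apply, LinearMap.comp_apply]
      rcases Finset.mem_insert.1 hw with rfl | hw
      · rw [← map_sub]
        refine hAb _ _ fun x => ?_
        have h1 : (B (fun x => f (x + w)) - B f) x =
            ((n : ℝ) + 1)⁻¹ * (f (x + (n + 1) • w) - f x) := by
          rw [Pi.sub_apply, hB, hB, ← mul_sub, ← Finset.sum_sub_distrib]
          congr 1
          have h2 := Finset.sum_range_sub (fun i => f (x + i • w)) (n + 1)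
          simp only [zero_smul, add_zero] at h2
          rw [← h2]
          exact Finset.sum_congr rfl fun i _ => by rw [succ_nsmul, add_assoc]
        rw [h1, abs_mul, abs_of_pos (inv_pos.2 hn), inv_mul_le_iff₀ hn,
          mul_div_cancel₀ _ hn.ne', two_mul]
        exact (abs_sub _ _).trans (add_le_add (hC _) (hC _))
      · have h1 : B (fun x => f (x + w)) = fun x => B f (x + w) := by
          ext x
          simp only [hB]
          congr 1
          exact Finset.sum_congr rfl fun i _ => by rw [add_right_comm]
        rw [h1]
        exact hAS w hw _ _ (hBb f C hC)

/-- Every abelian group carries a translation-invariant mean: a limit of almost invariant means. -/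
theorem exists_invariant_mean (X : Type*) [AddCommGroup X] :
    ∃ M : boundedFunctions X →ₗ[ℝ] ℝ,
      (∀ f : boundedFunctions X, (∀ x, 0 ≤ (f : X → ℝ) x) → 0 ≤ M f) ∧
      (∀ f : boundedFunctions X, (∀ x, (f : X → ℝ) x = 1) → M f = 1) ∧
      ∀ (w : X) (f f' : boundedFunctions X),
        (∀ x, (f' : X → ℝ) x = (f : X → ℝ) (x + w)) → M f' = M f := by
  classical
  choose A hAb hA0 hA1 hAS using fun i : Finset X × ℕ => exists_almost_invariant_mean i.1 i.2
  let U : Ultrafilter (Finset X × ℕ) := Ultrafilter.of atTop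
  have hlim : ∀ f : boundedFunctions X, ∃ L, Tendsto (fun i => A i f) U (𝓝 L) := by
    rintro ⟨f, C, hC⟩
    obtain ⟨L, -, hL⟩ := (isCompact_Icc (a := -C) (b := C)).ultrafilter_le_nhds'
      (U.map fun i => A i f) (Ultrafilter.mem_map.2 (univ_mem' fun i => abs_le.1 (hAb i f C hC)))
    exact ⟨L, hL⟩
  choose M hM using hlim
  refine ⟨{ toFun := M, map_add' := fun f g => ?_, map_smul' := fun c f => ?_ }, ?_, ?_, ?_⟩
  · refine tendsto_nhds_unique (hM (f + g)) ?_
    simpa using (hM f).add (hM g)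
  · refine tendsto_nhds_unique (hM (c • f)) ?_
    simpa using (hM f).const_mul c
  · exact fun f hf => ge_of_tendsto' (hM f) fun i => hA0 i _ hf
  · intro f hf
    have : (f : X → ℝ) = fun _ => 1 := funext hf
    refine tendsto_nhds_unique (hM f) ?_
    simp only [this, hA1, tendsto_const_nhds]
  · intro w f f' hff'
    obtain ⟨C, hC⟩ := f.2
    have e : (f' : X → ℝ) = fun x => (f : X → ℝ) (x + w) := funext hff'
    have h1 : Tendsto (fun i : Finset X × ℕ => A i f' - A i f) U (𝓝 0) := by
      have h2 : Tendsto (fun i : Finset X × ℕ => 2 * C / ((i.2 : ℝ) + 1)) U (𝓝 0) := by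
        have h3 : Tendsto (fun n : ℕ => 2 * C / ((n : ℝ) + 1)) atTop (𝓝 0) := by
          simpa [div_eq_mul_inv, one_div] using
            (tendsto_one_div_add_atTop_nhds_zero_nat (𝕜 := ℝ)).const_mul (2 * C)
        have h4 : Tendsto (Prod.snd : Finset X × ℕ → ℕ) atTop atTop := by
          rw [← prod_atTop_atTop_eq]; exact tendsto_snd
        exact (h3.comp h4).mono_left (Ultrafilter.of_le _)
      refine squeeze_zero_norm' ?_ h2
      have h5 : ∀ᶠ i : Finset X × ℕ in U, ({w}, 0) ≤ i :=
        Ultrafilter.of_le _ (eventually_ge_atTop _)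
      filter_upwards [h5] with i hi
      rw [Real.norm_eq_abs, e]
      exact hAS i w (hi.1 (Finset.mem_singleton_self w)) _ C hC
    exact sub_eq_zero.1 (tendsto_nhds_unique ((hM f').sub (hM f)) h1)

/-! ### Averaging a uniformly continuous map over the affine isometries -/

/-- A uniformly continuous map on a real normed space is bounded at every scale. -/
theorem UniformContinuous.exists_norm_sub_le {X E : Type*} [NormedAddCommGroup X] [NormedSpace ℝ X]
    [NormedAddCommGroup E] {φ : X → E} (hφ : UniformContinuous φ) (R : ℝ) :
    ∃ C, ∀ x y : X, ‖x - y‖ ≤ R → ‖φ x - φ y‖ ≤ C := by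
  obtain ⟨s, hs, h⟩ := Metric.uniformContinuous_iff.1 hφ 1 one_pos
  obtain ⟨n, hn⟩ := exists_nat_gt (R / s)
  have hstep : ∀ m : ℕ, ∀ x v : X, ‖v‖ < s → ‖φ (x + (m : ℝ) • v) - φ x‖ ≤ m := by
    intro m x v hv
    induction m with
    | zero => simp
    | succ m ih =>
      have h1 : ‖φ (x + ((m + 1 : ℕ) : ℝ) • v) - φ (x + (m : ℝ) • v)‖ ≤ 1 := by
        rw [← dist_eq_norm]
        refine (h ?_).le
        rw [dist_eq_norm]
        have : x + ((m + 1 : ℕ) : ℝ) • v - (x + (m : ℝ) • v) = v := by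
          push_cast; rw [add_smul, one_smul]; abel
        rwa [this]
      have h2 := norm_sub_le_norm_sub_add_norm_sub (φ (x + ((m + 1 : ℕ) : ℝ) • v))
        (φ (x + (m : ℝ) • v)) (φ x)
      push_cast at h1 h2 ⊢
      linarith
  refine ⟨n, fun x y hxy => ?_⟩
  have hn0 : (0 : ℝ) ≤ n := Nat.cast_nonneg n
  rcases hn0.eq_or_lt with h0 | h0
  · have hR : R < 0 := by
      rw [← h0] at hn
      by_contra hR
      exact absurd (div_nonneg (not_lt.1 hR) hs.le) (not_le.2 hn)
    exact absurd ((norm_nonneg _).trans hxy) (not_le.2 hR)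
  · have h1 := hstep n y ((n : ℝ)⁻¹ • (x - y)) (by
      rw [norm_smul, norm_inv, Real.norm_natCast, inv_mul_lt_iff₀ h0]
      rw [div_lt_iff₀ hs] at hn
      linarith)
    rwa [smul_smul, mul_inv_cancel₀ h0.ne', one_smul, add_sub_cancel] at h1

section Kernel

variable {𝕂 X E G : Type*} [RCLike 𝕂] [NormedAddCommGroup X] [NormedSpace ℝ X]
  [NormedAddCommGroup E] [NormedSpace 𝕂 E] [Group G]

/-- The linear extension to finitely supported functions of the map
`x ↦ φ (g⁻¹ • x + z) - φ z`, obtained from `φ` by an affine isometry. Subtracting `φ z` makes it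
bounded in `(g, z)`; the inverse makes it right uniformly continuous in `g`. -/
noncomputable def affineTranslate (𝕂 : Type*) [RCLike 𝕂] [NormedSpace 𝕂 E] (ρ : G →* (X ≃ₗᵢ[ℝ] X))
    (φ : X → E) (g : G) (z : X) : (X →₀ 𝕂) →ₗ[𝕂] E :=
  Finsupp.linearCombination 𝕂 fun x => φ (ρ g⁻¹ x + z) - φ z

variable (ρ : G →* (X ≃ₗᵢ[ℝ] X)) (φ : X → E)

theorem affineTranslate_single (g : G) (z x : X) :
    affineTranslate 𝕂 ρ φ g z (Finsupp.single x 1) = φ (ρ g⁻¹ x + z) - φ z := by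
  simp [affineTranslate]

variable {φ}

theorem exists_norm_affineTranslate_le (hφ : UniformContinuous φ) (ξ : X →₀ 𝕂) :
    ∃ C, ∀ g z, ‖affineTranslate 𝕂 ρ φ g z ξ‖ ≤ C := by
  induction ξ using Finsupp.induction_linear with
  | zero => exact ⟨0, fun g z => by simp⟩
  | add ξ η hξ hη =>
    obtain ⟨C, hC⟩ := hξ
    obtain ⟨D, hD⟩ := hη
    refine ⟨C + D, fun g z => ?_⟩
    rw [map_add]
    exact norm_add_le_of_le (hC g z) (hD g z)
  | single x a =>
    obtain ⟨C, hC⟩ := hφ.exists_norm_sub_le ‖x‖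
    refine ⟨‖a‖ * C, fun g z => ?_⟩
    rw [affineTranslate, Finsupp.linearCombination_single, norm_smul]
    gcongr
    exact hC _ _ (by simp)

theorem eventually_norm_affineTranslate_sub_lt [TopologicalSpace G] [IsTopologicalGroup G]
    (hρ : ∀ x : X, Continuous fun g : G => ρ g x) (hφ : UniformContinuous φ) (ξ : X →₀ 𝕂) {ε : ℝ}
    (hε : 0 < ε) : ∀ᶠ u in 𝓝 (1 : G), ∀ g z,
      ‖affineTranslate 𝕂 ρ φ (u * g) z ξ - affineTranslate 𝕂 ρ φ g z ξ‖ < ε := by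
  induction ξ using Finsupp.induction_linear generalizing ε with
  | zero => exact Eventually.of_forall fun u g z => by simpa using hε
  | add ξ η hξ hη =>
    filter_upwards [hξ (half_pos hε), hη (half_pos hε)] with u h1 h2 g z
    rw [map_add, map_add, add_sub_add_comm]
    exact (norm_add_le _ _).trans_lt ((add_lt_add (h1 g z) (h2 g z)).trans_eq (add_halves ε))
  | single x a =>
    obtain ⟨s, hs, h⟩ := Metric.uniformContinuous_iff.1 hφ (ε / (‖a‖ + 1)) (by positivity)
    have hc : Tendsto (fun u : G => ρ u⁻¹ x) (𝓝 1) (𝓝 x) := by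
      have h1 := ((hρ x).comp continuous_inv).tendsto (1 : G)
      rwa [Function.comp_apply, inv_one, map_one] at h1
    filter_upwards [hc (Metric.ball_mem_nhds x hs)] with u hu g z
    rw [affineTranslate, affineTranslate, Finsupp.linearCombination_single,
      Finsupp.linearCombination_single, ← smul_sub, norm_smul, sub_sub_sub_cancel_right,
      ← dist_eq_norm]
    have h1 : dist (ρ (u * g)⁻¹ x + z) (ρ g⁻¹ x + z) < s := by
      rw [dist_add_right, mul_inv_rev, map_mul, LinearIsometryEquiv.coe_mul, Function.comp_apply,
        LinearIsometryEquiv.dist_map]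
      exact hu
    have h2 := h h1
    rw [lt_div_iff₀ (by positivity)] at h2
    have h3 := dist_nonneg (x := φ (ρ (u * g)⁻¹ x + z)) (y := φ (ρ g⁻¹ x + z))
    nlinarith

/-- Averaging `ξ ↦ ‖∑ x, ξ x • (φ (g⁻¹ • x + z) - φ z)‖ ^ 2` over `z : X` and then over `g : G`
yields a member of the closed cone that is invariant under the translations and under `G`, and that
inherits all bounds valid for every `g` and `z`. -/
theorem exists_invariant_mem_squareCone [TopologicalSpace G] [IsTopologicalGroup G]
    (hG : IsAmenable G) (hρ : ∀ x : X, Continuous fun g : G => ρ g x)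
    (hφ : UniformContinuous φ) :
    ∃ Q : (X →₀ 𝕂) → ℝ, InSquareCone 𝕂 E Q ∧
      (∀ x y, Q (Finsupp.single x 1 - Finsupp.single y 1) = Q (Finsupp.single (x - y) 1)) ∧
      (∀ (a : G) x, Q (Finsupp.single (ρ a x) 1) = Q (Finsupp.single x 1)) ∧
      (∀ x C, (∀ g z, ‖φ (ρ g x + z) - φ z‖ ^ 2 ≤ C) → Q (Finsupp.single x 1) ≤ C) ∧
      ∀ x C, (∀ g z, C ≤ ‖φ (ρ g x + z) - φ z‖ ^ 2) → C ≤ Q (Finsupp.single x 1) := by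
  obtain ⟨m, hm0, hm1, hminv⟩ := hG
  obtain ⟨M, hM0, hM1, hMinv⟩ := exists_invariant_mean X
  let T : G → X → (X →₀ 𝕂) →ₗ[𝕂] E := affineTranslate 𝕂 ρ φ
  have hTs : ∀ g z x, T g z (Finsupp.single x 1) = φ (ρ g⁻¹ x + z) - φ z :=
    affineTranslate_single ρ φ
  have hMone : (fun _ => 1 : X → ℝ) ∈ boundedFunctions X := ⟨1, fun _ => by simp⟩
  have hmone : (fun _ => 1 : G → ℝ) ∈ RUCB G :=
    ⟨⟨1, fun _ => by simp⟩, fun ε hε => Eventually.of_forall fun u x => by simpa using hε⟩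
  have hTb : ∀ g ξ, (fun z => ‖T g z ξ‖ ^ 2) ∈ boundedFunctions X := by
    intro g ξ
    obtain ⟨C, hC⟩ := exists_norm_affineTranslate_le (𝕂 := 𝕂) ρ hφ ξ
    refine ⟨C ^ 2, fun z => ?_⟩
    rw [abs_of_nonneg (by positivity)]
    exact pow_le_pow_left₀ (norm_nonneg _) (hC g z) 2
  -- `q g` is the mean over all translations.
  let q : G → (X →₀ 𝕂) → ℝ := fun g ξ => M ⟨fun z => ‖T g z ξ‖ ^ 2, hTb g ξ⟩
  have hqcone : ∀ g, InSquareCone 𝕂 E (q g) := fun g =>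
    InSquareCone.of_positive M hM0 (fun z => InSquareCone.of_linearMap (T g z)) (hTb g)
  have hqle : ∀ g ξ C, (∀ z, ‖T g z ξ‖ ^ 2 ≤ C) → q g ξ ≤ C := fun g ξ C h =>
    (le_abs_self _).trans (abs_le_of_positive M hM0 hM1 hMone _ fun z => by
      simpa only [abs_of_nonneg (sq_nonneg ‖T g z ξ‖)] using h z)
  have hqge : ∀ g ξ C, (∀ z, C ≤ ‖T g z ξ‖ ^ 2) → C ≤ q g ξ := by
    intro g ξ C h
    have h1 := hM0 (⟨fun z => ‖T g z ξ‖ ^ 2, hTb g ξ⟩ - C • ⟨fun _ => 1, hMone⟩) fun z => by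
      simpa using h z
    rw [map_sub, map_smul, hM1 ⟨fun _ => 1, hMone⟩ fun _ => rfl, smul_eq_mul, mul_one] at h1
    exact sub_nonneg.1 h1
  have hqS : ∀ ξ, (fun g => q g ξ) ∈ RUCB G := by
    intro ξ
    obtain ⟨C, hC⟩ := exists_norm_affineTranslate_le (𝕂 := 𝕂) ρ hφ ξ
    have hC0 : 0 ≤ C := (norm_nonneg _).trans (hC 1 0)
    refine ⟨⟨C ^ 2, fun g => ?_⟩, fun ε hε => ?_⟩
    · rw [abs_of_nonneg ((hqcone g).nonneg ξ)]
      exact hqle g ξ _ fun z => by gcongr; exact hC g z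
    · filter_upwards [eventually_norm_affineTranslate_sub_lt (𝕂 := 𝕂) ρ hρ hφ ξ
        (ε := ε / (4 * C + 1)) (by positivity)] with u hu g
      have h1 : q (u * g) ξ - q g ξ = M (⟨fun z => ‖T (u * g) z ξ‖ ^ 2, hTb (u * g) ξ⟩ -
          ⟨fun z => ‖T g z ξ‖ ^ 2, hTb g ξ⟩) := (map_sub M _ _).symm
      have h2 : |q (u * g) ξ - q g ξ| ≤ ε / (4 * C + 1) * (2 * C) := by
        rw [h1]
        refine abs_le_of_positive M hM0 hM1 hMone _ fun z => ?_
        change |‖T (u * g) z ξ‖ ^ 2 - ‖T g z ξ‖ ^ 2| ≤ _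
        rw [sq_sub_sq, abs_mul, mul_comm]
        have h3 := abs_norm_sub_norm_le (T (u * g) z ξ) (T g z ξ)
        refine mul_le_mul (h3.trans (hu g z).le) ?_ (abs_nonneg _) (by positivity)
        rw [abs_of_nonneg (by positivity)]
        linarith [hC (u * g) z, hC g z]
      refine h2.trans_lt ?_
      rw [div_mul_eq_mul_div, div_lt_iff₀ (by positivity)]
      nlinarith
  let Q : (X →₀ 𝕂) → ℝ := fun ξ => m ⟨fun g => q g ξ, hqS ξ⟩
  have hQcone : InSquareCone 𝕂 E Q := InSquareCone.of_positive m hm0 hqcone hqS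
  have hQcongr : ∀ ξ η, (∀ g, q g ξ = q g η) → Q ξ = Q η := by
    intro ξ η h
    exact congrArg m (Subtype.ext (funext h))
  have hQle : ∀ ξ C, (∀ g z, ‖T g z ξ‖ ^ 2 ≤ C) → Q ξ ≤ C := fun ξ C h =>
    (le_abs_self _).trans (abs_le_of_positive m hm0 hm1 hmone _ fun g => by
      simpa only [abs_of_nonneg ((hqcone g).nonneg ξ)] using hqle g ξ C (h g))
  have hQge : ∀ ξ C, (∀ g z, C ≤ ‖T g z ξ‖ ^ 2) → C ≤ Q ξ := by
    intro ξ C h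
    have h1 := hm0 (⟨fun g => q g ξ, hqS ξ⟩ - C • ⟨fun _ => 1, hmone⟩) fun g => by
      simpa using hqge g ξ C (h g)
    rw [map_sub, map_smul, hm1 ⟨fun _ => 1, hmone⟩ fun _ => rfl, smul_eq_mul, mul_one] at h1
    exact sub_nonneg.1 h1
  have htrans : ∀ x y, Q (Finsupp.single x 1 - Finsupp.single y 1) =
      Q (Finsupp.single (x - y) 1) := by
    refine fun x y => hQcongr _ _ fun g => ?_
    refine hMinv (ρ g⁻¹ y) _ _ fun z => ?_
    change ‖T g z _‖ ^ 2 = ‖T g (z + ρ g⁻¹ y) _‖ ^ 2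
    rw [map_sub, hTs, hTs, hTs, sub_sub_sub_cancel_right, map_sub, sub_add_add_cancel, add_comm z]
  have hrot : ∀ (a : G) x, Q (Finsupp.single (ρ a x) 1) = Q (Finsupp.single x 1) := by
    refine fun a x => hminv a⁻¹ _ _ fun g => ?_
    change q g _ = q (a⁻¹ * g) _
    refine congrArg M (Subtype.ext (funext fun z => ?_))
    change ‖T g z _‖ ^ 2 = ‖T (a⁻¹ * g) z _‖ ^ 2
    rw [hTs, hTs, mul_inv_rev, inv_inv, map_mul, LinearIsometryEquiv.coe_mul, Function.comp_apply]
  refine ⟨Q, hQcone, htrans, hrot, fun x C h => hQle _ _ fun g z => ?_,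
    fun x C h => hQge _ _ fun g z => ?_⟩
  · rw [hTs]; exact h _ _
  · rw [hTs]; exact h _ _

/-- The invariant kernel: averaging `‖φ x - φ y‖ ^ 2` over the translations and over `G` yields a
quantity that depends on `‖x - y‖` only, because the orbits of `G` are dense in the spheres. -/
theorem exists_invariant_kernel [TopologicalSpace G] [IsTopologicalGroup G] (hG : IsAmenable G)
    (hρ : ∀ x : X, Continuous fun g : G => ρ g x)
    (hdense : ∃ x₀ ∈ Metric.sphere (0 : X) 1,
      Metric.sphere (0 : X) 1 ⊆ closure (Set.range fun g : G => ρ g x₀))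
    (hφ : UniformContinuous φ) {r δ : ℝ} (hr : 0 < r) (hδ : 0 < δ)
    (hrδ : ∀ x y : X, ‖x - y‖ = r → δ ≤ ‖φ x - φ y‖) :
    ∃ (Q : (X →₀ 𝕂) → ℝ) (k : ℝ → ℝ), InSquareCone 𝕂 E Q ∧
      (∀ x y, Q (Finsupp.single x 1 - Finsupp.single y 1) = k ‖x - y‖) ∧
      (∀ x, Q (Finsupp.single x 1) = k ‖x‖) ∧ δ ^ 2 ≤ k r ∧
      ∀ ε > 0, ∃ s > 0, ∀ t, 0 ≤ t → t ≤ s → k t ≤ ε := by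
  obtain ⟨Q, hQcone, htrans, hrot, hQle, hQge⟩ :=
    exists_invariant_mem_squareCone (𝕂 := 𝕂) ρ hG hρ hφ
  obtain ⟨x₀, hx₀, hx₀d⟩ := hdense
  rw [mem_sphere_zero_iff_norm] at hx₀
  have hsmall : ∀ ε > 0, ∃ s > 0, ∀ x : X, ‖x‖ ≤ s → Q (Finsupp.single x 1) ≤ ε := by
    intro ε hε
    obtain ⟨s, hs, h⟩ := Metric.uniformContinuous_iff.1 hφ (√ε) (Real.sqrt_pos.2 hε)
    refine ⟨s / 2, half_pos hs, fun x hx => hQle _ _ fun g z => ?_⟩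
    rw [← dist_eq_norm]
    have h1 : dist (ρ g x + z) z < s := by
      rw [dist_eq_norm, add_sub_cancel_right, LinearIsometryEquiv.norm_map]
      linarith
    calc dist (φ (ρ g x + z)) (φ z) ^ 2 ≤ √ε ^ 2 := by gcongr; exact (h h1).le
      _ = ε := Real.sq_sqrt hε.le
  have hcont : Continuous fun x : X => √(Q (Finsupp.single x 1)) := by
    rw [Metric.continuous_iff]
    intro x ε hε
    obtain ⟨s, hs, h⟩ := hsmall ((ε / 2) ^ 2) (by positivity)
    refine ⟨s, hs, fun y hy => ?_⟩
    rw [dist_eq_norm] at hy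
    have key : ∀ x y : X, √(Q (Finsupp.single x 1)) ≤
        √(Q (Finsupp.single (x - y) 1)) + √(Q (Finsupp.single y 1)) := fun x y => by
      rw [← htrans]
      calc √(Q (Finsupp.single x 1))
          = √(Q (Finsupp.single x 1 - Finsupp.single y 1 + Finsupp.single y 1)) := by
            rw [sub_add_cancel]
        _ ≤ _ := hQcone.sqrt_add_le _ _
    have h1 : ∀ x : X, ‖x‖ ≤ s → √(Q (Finsupp.single x 1)) ≤ ε / 2 := fun x hx =>
      Real.sqrt_le_iff.2 ⟨by positivity, h x hx⟩
    have h2 := key x y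
    have h3 := key y x
    have h4 := h1 (y - x) hy.le
    have h5 := h1 (x - y) (by rw [norm_sub_rev]; exact hy.le)
    rw [Real.dist_eq, abs_lt]
    constructor <;> linarith
  have hradial : ∀ x : X, Q (Finsupp.single x 1) = Q (Finsupp.single (‖x‖ • x₀) 1) := by
    intro x
    rcases eq_or_ne x 0 with rfl | hx
    · simp
    have hx' : ‖x‖ ≠ 0 := norm_ne_zero_iff.2 hx
    have hmem : ‖x‖⁻¹ • x ∈ closure (Set.range fun g : G => ρ g x₀) :=
      hx₀d (by rw [mem_sphere_zero_iff_norm, norm_smul, norm_inv, norm_norm, inv_mul_cancel₀ hx'])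
    have hclosed : IsClosed {y : X | √(Q (Finsupp.single (‖x‖ • y) 1)) =
        √(Q (Finsupp.single (‖x‖ • x₀) 1))} :=
      isClosed_eq (hcont.comp (continuous_const_smul ‖x‖)) continuous_const
    have hsub : (Set.range fun g : G => ρ g x₀) ⊆ {y : X | √(Q (Finsupp.single (‖x‖ • y) 1)) =
        √(Q (Finsupp.single (‖x‖ • x₀) 1))} := by
      rintro _ ⟨g, rfl⟩
      change √(Q (Finsupp.single (‖x‖ • ρ g x₀) 1)) = _
      rw [← map_smul, hrot]
    have h1 : √(Q (Finsupp.single (‖x‖ • ‖x‖⁻¹ • x) 1)) = √(Q (Finsupp.single (‖x‖ • x₀) 1)) :=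
      closure_minimal hsub hclosed hmem
    rw [smul_inv_smul₀ hx'] at h1
    exact (Real.sqrt_inj (hQcone.nonneg _) (hQcone.nonneg _)).1 h1
  refine ⟨Q, fun t => Q (Finsupp.single (t • x₀) 1), hQcone, fun x y => ?_, hradial, ?_, ?_⟩
  · rw [htrans, hradial]
  · refine hQge _ _ fun g z => ?_
    refine pow_le_pow_left₀ hδ.le (hrδ _ _ ?_) 2
    rw [add_sub_cancel_right, LinearIsometryEquiv.norm_map, norm_smul, hx₀, mul_one,
      Real.norm_of_nonneg hr.le]
  · intro ε hε
    obtain ⟨s, hs, h⟩ := hsmall ε hε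
    refine ⟨s, hs, fun t ht hts => h _ ?_⟩
    rwa [norm_smul, hx₀, mul_one, Real.norm_of_nonneg ht]

end Kernel

/-! ### Unbounded kernels -/

/-- A kernel that does not vanish at the distance `r` is turned into an unbounded one, by summing
its rescalings by small factors `c n` with the growing weights `n + 1`. The factors are so small
that the `n`-th summand is at most `2⁻ⁿ` at distances up to `n + 1`. -/
theorem exists_unbounded_kernel {𝕂 X E : Type*} [RCLike 𝕂] [NormedAddCommGroup X] [NormedSpace ℝ X]
    [Nontrivial X] [NormedAddCommGroup E] [NormedSpace 𝕂 E] {Q : (X →₀ 𝕂) → ℝ} {k : ℝ → ℝ}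
    (hQ : InSquareCone 𝕂 E Q)
    (hQk : ∀ x y, Q (Finsupp.single x 1 - Finsupp.single y 1) = k ‖x - y‖)
    (hQk' : ∀ x, Q (Finsupp.single x 1) = k ‖x‖) {r a : ℝ} (hr : 0 < r) (ha : 0 < a) (hra : a ≤ k r)
    (hk : ∀ ε > 0, ∃ s > 0, ∀ t, 0 ≤ t → t ≤ s → k t ≤ ε) :
    ∃ (Q' : (X →₀ 𝕂) → ℝ) (k' : ℝ → ℝ), InSquareCone 𝕂 E Q' ∧
      (∀ x y, Q' (Finsupp.single x 1 - Finsupp.single y 1) = k' ‖x - y‖) ∧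
      Tendsto k' (𝓝[≥] 0) (𝓝 0) ∧ ∀ B, ∃ t, 0 ≤ t ∧ B ≤ k' t := by
  have hk0 : ∀ t, 0 ≤ t → 0 ≤ k t := by
    intro t ht
    obtain ⟨x, hx⟩ := NormedSpace.exists_lt_norm ℝ X 0
    have h1 := hQk' ((t * ‖x‖⁻¹) • x)
    rw [norm_smul, norm_mul, norm_inv, norm_norm, mul_assoc, inv_mul_cancel₀ hx.ne', mul_one,
      Real.norm_of_nonneg ht] at h1
    rw [← h1]
    exact hQ.nonneg _
  choose s hs hsk using fun n : ℕ =>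
    hk ((1 / 2 : ℝ) ^ n / ((n : ℝ) + 1)) (by positivity)
  let c : ℕ → ℝ := fun n => s n / ((n : ℝ) + 1)
  have hc : ∀ n, 0 < c n := fun n => div_pos (hs n) (by positivity)
  let f : ℝ → ℕ → ℝ := fun t n => ((n : ℝ) + 1) * k (c n * t)
  have hf0 : ∀ t n, 0 ≤ t → 0 ≤ f t n := fun t n ht =>
    mul_nonneg (by positivity) (hk0 _ (mul_nonneg (hc n).le ht))
  have hfle : ∀ t, ∀ n : ℕ, 0 ≤ t → t ≤ (n : ℝ) + 1 → f t n ≤ (1 / 2 : ℝ) ^ n := by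
    intro t n ht htn
    have hn : (0 : ℝ) < n + 1 := by positivity
    have h1 : c n * t ≤ s n := by
      calc c n * t ≤ c n * ((n : ℝ) + 1) := by gcongr; exact (hc n).le
        _ = s n := div_mul_cancel₀ _ hn.ne'
    have h2 := hsk n _ (mul_nonneg (hc n).le ht) h1
    rwa [le_div_iff₀ hn, mul_comm] at h2
  have hfs : ∀ t, 0 ≤ t → Summable (f t) := by
    intro t ht
    refine Summable.of_norm_bounded_eventually_nat summable_geometric_two ?_
    obtain ⟨N, hN⟩ := exists_nat_ge t
    filter_upwards [eventually_ge_atTop N] with n hn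
    rw [Real.norm_of_nonneg (hf0 t n ht)]
    have : (N : ℝ) ≤ n := by exact_mod_cast hn
    exact hfle t n ht (by linarith)
  let L : ℕ → (X →₀ 𝕂) →ₗ[𝕂] (X →₀ 𝕂) := fun n => Finsupp.lmapDomain 𝕂 𝕂 (c n • ·)
  have hL : ∀ n x, L n (Finsupp.single x 1) = Finsupp.single (c n • x) 1 := fun n x => by
    simp [L, Finsupp.mapDomain_single]
  let q : ℕ → (X →₀ 𝕂) → ℝ := fun n ξ => ((n : ℝ) + 1) * Q (L n ξ)
  have hq : ∀ n, InSquareCone 𝕂 E (q n) := fun n => (hQ.comp (L n)).const_mul (by positivity)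
  have hqs : ∀ ξ, Summable fun n => q n ξ := by
    intro ξ
    induction ξ using Finsupp.induction_linear with
    | zero => simpa only [(hq _).map_zero] using summable_zero
    | add ξ η hξ hη =>
      refine ((hξ.mul_left 2).add (hη.mul_left 2)).of_nonneg_of_le
        (fun n => (hq n).nonneg _) fun n => ?_
      have := (hq n).map_add_le ξ η one_pos
      norm_num at this
      exact this
    | single x b =>
      have h1 : ∀ n, q n (Finsupp.single x b) = ‖b‖ ^ 2 * f ‖x‖ n := by
        intro n
        have h2 : Finsupp.single x b = b • Finsupp.single x (1 : 𝕂) := by simp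
        rw [h2, (hq n).map_smul]
        change _ * (_ * Q (L n _)) = _ * (_ * _)
        rw [hL, hQk', norm_smul, Real.norm_of_nonneg (hc n).le]
      simp only [h1]
      exact (hfs _ (norm_nonneg x)).mul_left _
  refine ⟨fun ξ => ∑' n, q n ξ, fun t => ∑' n, f t n,
    InSquareCone.of_hasSum hq fun ξ => (hqs ξ).hasSum, fun x y => tsum_congr fun n => ?_, ?_, ?_⟩
  · change _ * Q (L n _) = _ * _
    rw [map_sub, hL, hL, hQk, ← smul_sub, norm_smul, Real.norm_of_nonneg (hc n).le]
  · have hterm : ∀ n, Tendsto (fun t => f t n) (𝓝[≥] 0) (𝓝 0) := by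
      intro n
      have hn : (0 : ℝ) < n + 1 := by positivity
      rw [Metric.tendsto_nhdsWithin_nhds]
      intro ε hε
      obtain ⟨σ, hσ, h⟩ := hk (ε / 2 / ((n : ℝ) + 1)) (by positivity)
      refine ⟨σ / c n, div_pos hσ (hc n), fun t ht htσ => ?_⟩
      have ht0 : (0 : ℝ) ≤ t := ht
      rw [dist_zero_right, Real.norm_of_nonneg ht0, lt_div_iff₀ (hc n), mul_comm] at htσ
      have h1 := h _ (mul_nonneg (hc n).le ht0) htσ.le
      rw [le_div_iff₀ hn, mul_comm] at h1
      rw [dist_zero_right, Real.norm_of_nonneg (hf0 t n ht0)]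
      exact h1.trans_lt (half_lt_self hε)
    have hdom : ∀ᶠ t in 𝓝[≥] (0 : ℝ), ∀ n, ‖f t n‖ ≤ (1 / 2 : ℝ) ^ n := by
      filter_upwards [self_mem_nhdsWithin,
        mem_nhdsWithin_of_mem_nhds (Iio_mem_nhds (zero_lt_one (α := ℝ)))] with t ht0 ht1 n
      have ht0' : (0 : ℝ) ≤ t := ht0
      have ht1' : t < 1 := ht1
      rw [Real.norm_of_nonneg (hf0 t n ht0')]
      exact hfle t n ht0' (by linarith [(Nat.cast_nonneg n : (0 : ℝ) ≤ n)])
    simpa using tendsto_tsum_of_dominated_convergence summable_geometric_two hterm hdom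
  · intro B
    obtain ⟨n, hn⟩ := exists_nat_ge (B / a)
    have ht : 0 ≤ r / c n := div_nonneg hr.le (hc n).le
    refine ⟨r / c n, ht, ?_⟩
    have h1 : f (r / c n) n ≤ ∑' m, f (r / c n) m :=
      (hfs _ ht).le_tsum n fun j _ => hf0 _ j ht
    refine le_trans ?_ h1
    change B ≤ ((n : ℝ) + 1) * k (c n * (r / c n))
    rw [mul_div_cancel₀ _ (hc n).ne']
    rw [div_le_iff₀ ha] at hn
    nlinarith [(Nat.cast_nonneg n : (0 : ℝ) ≤ n)]

/-! ### Maps whose displacement depends on the distance only -/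

/-- In real dimension at least two, every distance `s ≤ 2 * t` is realized by the third side of a
triangle whose other sides have length `t`, because spheres are connected. -/
theorem exists_isosceles_triangle {X : Type*} [NormedAddCommGroup X] [NormedSpace ℝ X]
    (hX : 1 < Module.rank ℝ X) {s t : ℝ} (hs : 0 ≤ s) (hst : s ≤ 2 * t) :
    ∃ x y : X, ‖x‖ = t ∧ ‖y‖ = t ∧ ‖x - y‖ = s := by
  have ht : 0 ≤ t := by linarith
  have : Nontrivial X := rank_pos_iff_nontrivial.1 (zero_lt_one.trans hX)
  obtain ⟨x, hx⟩ := exists_norm_eq X ht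
  have hpre := isPreconnected_sphere hX (0 : X) t
  have hmem := hpre.intermediate_value (a := x) (b := -x) (f := fun y => ‖x - y‖)
    (by simpa using hx) (by simpa using hx) (by fun_prop)
  have hsm : s ∈ Set.Icc ‖x - x‖ ‖x - -x‖ := by
    rw [sub_self, norm_zero, sub_neg_eq_add, ← two_smul ℝ x, norm_smul, hx]
    exact ⟨hs, by simpa using hst⟩
  obtain ⟨y, hy, hys⟩ := hmem hsm
  exact ⟨x, y, hx, by simpa using hy, hys⟩

/-- If `‖f x - f y‖ = D ‖x - y‖` where `D` vanishes at `0` continuously and is unbounded, then `f`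
is a uniform and coarse embedding in real dimension at least two. Indeed, the triangle inequality
gives `D s ≤ 2 * D t` for `s ≤ 2 * t`. Hence `D` would be bounded everywhere if it were bounded
along a sequence tending to infinity, or if it vanished at some `t > 0`. -/
theorem isUniformEmbedding_and_isCoarseEmbedding {X V : Type*} [NormedAddCommGroup X]
    [NormedSpace ℝ X] (hX : 1 < Module.rank ℝ X) [NormedAddCommGroup V] {f : X → V} {D : ℝ → ℝ}
    (hf : ∀ x y, ‖f x - f y‖ = D ‖x - y‖) (hD0 : Tendsto D (𝓝[≥] 0) (𝓝 0))
    (hD : ∀ B, ∃ t, 0 ≤ t ∧ B ≤ D t) : IsUniformEmbedding f ∧ IsCoarseEmbedding f := by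
  have hdouble : ∀ s t, 0 ≤ s → s ≤ 2 * t → D s ≤ 2 * D t := by
    intro s t hs hst
    obtain ⟨x, y, hx, hy, hxy⟩ := exists_isosceles_triangle hX hs hst
    have h := norm_sub_le_norm_sub_add_norm_sub (f x) (f 0) (f y)
    rw [hf, hf, hf, hxy, sub_zero, hx, zero_sub, norm_neg, hy] at h
    linarith
  have hpos : ∀ t, 0 < t → 0 < D t := by
    intro t ht
    by_contra hneg
    push Not at hneg
    have h1 : ∀ n : ℕ, ∀ s, 0 ≤ s → s ≤ 2 ^ n * t → D s ≤ 0 := by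
      intro n
      induction n with
      | zero =>
        intro s hs hst
        linarith [hdouble s t hs (by linarith)]
      | succ n ih =>
        intro s hs hst
        have h2 := ih (s / 2) (by positivity) (by rw [pow_succ] at hst; linarith)
        linarith [hdouble s (s / 2) hs (by linarith)]
    obtain ⟨s, hs, hs1⟩ := hD 1
    obtain ⟨n, hn⟩ := pow_unbounded_of_one_lt (s / t) one_lt_two
    rw [div_lt_iff₀ ht] at hn
    linarith [h1 n s hs hn.le]
  constructor
  · rw [Metric.isUniformEmbedding_iff']
    constructor
    · intro ε hε
      obtain ⟨δ, hδ, h⟩ := Metric.tendsto_nhdsWithin_nhds.1 hD0 ε hε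
      refine ⟨δ, hδ, fun {x y} hxy => ?_⟩
      rw [dist_eq_norm, hf]
      have h1 := h (x := ‖x - y‖) (norm_nonneg _) (by simpa [dist_eq_norm] using hxy)
      rw [dist_zero_right] at h1
      exact (le_abs_self _).trans_lt h1
    · intro δ hδ
      refine ⟨D δ / 2, half_pos (hpos δ hδ), fun {x y} hxy => ?_⟩
      rw [dist_eq_norm, hf] at hxy
      by_contra hle
      rw [dist_eq_norm, not_lt] at hle
      linarith [hdouble δ ‖x - y‖ hδ.le (by linarith)]
  · intro x y
    simp only [hf]
    constructor
    · intro h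
      refine tendsto_atTop.2 fun B => ?_
      obtain ⟨t, ht, htB⟩ := hD (2 * B)
      filter_upwards [tendsto_atTop.1 h t] with n hn
      linarith [hdouble t _ ht (by linarith)]
    · intro h
      refine tendsto_atTop.2 fun R => ?_
      filter_upwards [tendsto_atTop.1 h (2 * D |R| + 1)] with n hn
      by_contra hlt
      rw [not_le] at hlt
      linarith [hdouble _ |R| (norm_nonneg (x n - y n)) (by linarith [le_abs_self R, abs_nonneg R])]

/-! ### The embedding -/

/-- The case of real dimension one: `X` is isometric to the real line, which embeds into the scalar
field of `E`. -/
theorem exists_embedding_of_rank_le_one {𝕂 : Type} [RCLike 𝕂] {X : Type u} [NormedAddCommGroup X]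
    [NormedSpace ℝ X] (hX : Module.rank ℝ X ≤ 1) {x₀ : X} (hx₀ : ‖x₀‖ = 1)
    {E : Type v} [NormedAddCommGroup E] [NormedSpace 𝕂 E] [Nontrivial E] :
    ∃ (V : Type u) (_ : NormedAddCommGroup V) (_ : NormedSpace 𝕂 V),
      CompleteSpace V ∧
      FinitelyRepresentable 𝕂 V (Lp E 2 (volume.restrict (Set.Icc (0 : ℝ) 1))) ∧
      ∃ f : X → V, IsUniformEmbedding f ∧ IsCoarseEmbedding f := by
  refine ⟨ULift.{u} 𝕂, inferInstance, inferInstance,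
    (completeSpace_congr (e := Equiv.ulift) (Isometry.isUniformEmbedding fun _ _ => rfl)).2
      inferInstance, ?_, ?_⟩
  · intro F _ ε hε
    obtain ⟨y, hy⟩ := exists_ne (0 : E)
    obtain ⟨S, hS⟩ := exists_linearMap_L2 fun _ : Fin 1 =>
      LinearMap.toSpanSingleton 𝕂 E (((‖y‖⁻¹ : ℝ) : 𝕂) • y)
    have hS' : ∀ a : 𝕂, ‖S a‖ = ‖a‖ := by
      intro a
      have h := hS a
      simp only [Finset.univ_unique, Finset.sum_const, Finset.card_singleton, one_smul,
        LinearMap.toSpanSingleton_apply, norm_smul, RCLike.norm_ofReal, abs_inv, abs_norm,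
        inv_mul_cancel₀ (norm_ne_zero_iff.2 hy), mul_one] at h
      exact (pow_left_inj₀ (norm_nonneg _) (norm_nonneg _) two_ne_zero).1 h
    refine ⟨S ∘ₗ (ULift.moduleEquiv (R := 𝕂) (M := 𝕂)).toLinearMap ∘ₗ F.subtype, fun v => ?_⟩
    have hv : ‖(S ∘ₗ (ULift.moduleEquiv (R := 𝕂) (M := 𝕂)).toLinearMap ∘ₗ F.subtype) v‖ = ‖v‖ :=
      hS' _
    rw [hv]
    exact ⟨le_rfl, by nlinarith [norm_nonneg v]⟩
  · obtain ⟨v₀, hv₀⟩ := rank_le_one_iff.1 hX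
    have hc : ∀ x : X, ∃ c : ℝ, c • x₀ = x := by
      intro x
      obtain ⟨a, ha⟩ := hv₀ x₀
      obtain ⟨b, hb⟩ := hv₀ x
      have ha0 : a ≠ 0 := by
        rintro rfl
        rw [zero_smul] at ha
        simp [← ha] at hx₀
      exact ⟨b * a⁻¹, by rw [← ha, smul_smul, inv_mul_cancel_right₀ ha0, hb]⟩
    choose c hc using hc
    have hf : ∀ x y : X, ‖ULift.up.{u} ((c x : ℝ) : 𝕂) - ULift.up ((c y : ℝ) : 𝕂)‖ = ‖x - y‖ := by
      intro x y
      change ‖((c x : ℝ) : 𝕂) - ((c y : ℝ) : 𝕂)‖ = _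
      rw [← RCLike.ofReal_sub, RCLike.norm_ofReal]
      conv_rhs => rw [← hc x, ← hc y, ← sub_smul, norm_smul, hx₀, mul_one, Real.norm_eq_abs]
    refine ⟨fun x => ULift.up ((c x : ℝ) : 𝕂), Isometry.isUniformEmbedding
      (Isometry.of_dist_eq fun x y => by rw [dist_eq_norm, dist_eq_norm, hf]), fun x y => ?_⟩
    simp only [hf]

/-- The theorem for a real Banach space `X`; a complex one is regarded as a real one. -/
theorem exists_embedding_of_real {𝕂 : Type} [RCLike 𝕂]
    {X : Type u} [NormedAddCommGroup X] [NormedSpace ℝ X]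
    {E : Type v} [NormedAddCommGroup E] [NormedSpace 𝕂 E]
    {G : Type w} [Group G] [TopologicalSpace G] [IsTopologicalGroup G]
    (hG : IsAmenable G)
    (ρ : G →* (X ≃ₗᵢ[ℝ] X))
    (hρ : ∀ x : X, Continuous fun g : G => ρ g x)
    (hdense : ∃ x₀ ∈ Metric.sphere (0 : X) 1,
      Metric.sphere (0 : X) 1 ⊆ closure (Set.range fun g : G => ρ g x₀))
    (φ : X → E) (hφ : UniformContinuous φ)
    (huncollapsed : ∃ r : ℝ, 0 < r ∧ ∃ δ : ℝ, 0 < δ ∧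
      ∀ x y : X, ‖x - y‖ = r → δ ≤ ‖φ x - φ y‖) :
    ∃ (V : Type u) (_ : NormedAddCommGroup V) (_ : NormedSpace 𝕂 V),
      CompleteSpace V ∧
      FinitelyRepresentable 𝕂 V (Lp E 2 (volume.restrict (Set.Icc (0 : ℝ) 1))) ∧
      ∃ f : X → V, IsUniformEmbedding f ∧ IsCoarseEmbedding f := by
  obtain ⟨r, hr, δ, hδ, hrδ⟩ := huncollapsed
  obtain ⟨x₀, hx₀s, hx₀d⟩ := hdense
  have hx₀ : ‖x₀‖ = 1 := mem_sphere_zero_iff_norm.1 hx₀s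
  rcases le_or_gt (Module.rank ℝ X) 1 with hX | hX
  · have h1 : δ ≤ ‖φ (r • x₀) - φ 0‖ :=
      hrδ _ _ (by rw [sub_zero, norm_smul, hx₀, mul_one, Real.norm_of_nonneg hr.le])
    have : Nontrivial E := ⟨⟨φ (r • x₀), φ 0, fun h => by simp [h] at h1; linarith⟩⟩
    exact exists_embedding_of_rank_le_one hX hx₀
  · have : Nontrivial X := rank_pos_iff_nontrivial.1 (zero_lt_one.trans hX)
    obtain ⟨Q₀, k₀, hQ₀, hQk₀, hQk₀', hkr, hk₀⟩ :=
      exists_invariant_kernel (𝕂 := 𝕂) ρ hG hρ ⟨x₀, hx₀s, hx₀d⟩ hφ hr hδ hrδ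
    obtain ⟨Q, k, hQ, hQk, hk0, hkB⟩ :=
      exists_unbounded_kernel hQ₀ hQk₀ hQk₀' hr (by positivity) hkr hk₀
    let : SeminormedAddCommGroup (X →₀ 𝕂) := hQ.seminormedAddCommGroup
    have hnorm : ∀ ξ : X →₀ 𝕂, ‖ξ‖ = √(Q ξ) := fun _ => rfl
    let : NormedSpace 𝕂 (X →₀ 𝕂) :=
      { norm_smul_le := fun a ξ => by
          rw [hnorm, hnorm, hQ.map_smul, Real.sqrt_mul (by positivity),
            Real.sqrt_sq (norm_nonneg a)] }
    have hQ' : InSquareCone 𝕂 E fun ξ : X →₀ 𝕂 => ‖ξ‖ ^ 2 := by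
      have : (fun ξ : X →₀ 𝕂 => ‖ξ‖ ^ 2) = Q := funext fun ξ => by
        rw [hnorm, Real.sq_sqrt (hQ.nonneg ξ)]
      rw [this]
      exact hQ
    refine ⟨UniformSpace.Completion (X →₀ 𝕂), inferInstance, inferInstance, inferInstance,
      hQ'.finitelyRepresentable, fun x => ((Finsupp.single x 1 : X →₀ 𝕂) :
        UniformSpace.Completion (X →₀ 𝕂)),
      isUniformEmbedding_and_isCoarseEmbedding hX (D := fun t => √(k t)) (fun x y => ?_) ?_ ?_⟩
    · rw [← UniformSpace.Completion.coe_sub, UniformSpace.Completion.norm_coe, hnorm, hQk]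
    · simpa using hk0.sqrt
    · intro B
      obtain ⟨t, ht, hB⟩ := hkB (B ^ 2)
      exact ⟨t, ht, Real.le_sqrt_of_sq_le hB⟩

theorem theorem1 {𝕜 𝕂 : Type} [RCLike 𝕜] [RCLike 𝕂]
    {X : Type u} [NormedAddCommGroup X] [NormedSpace 𝕜 X] [CompleteSpace X]
    {E : Type v} [NormedAddCommGroup E] [NormedSpace 𝕂 E] [CompleteSpace E]
    {G : Type w} [Group G] [TopologicalSpace G] [IsTopologicalGroup G]
    (hG : IsAmenable G)
    (ρ : G →* (X ≃ₗᵢ[𝕜] X))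
    (hρ : ∀ x : X, Continuous fun g : G => ρ g x)
    (hdense : ∃ x₀ ∈ Metric.sphere (0 : X) 1,
      Metric.sphere (0 : X) 1 ⊆ closure (Set.range fun g : G => ρ g x₀))
    (φ : X → E) (hφ : UniformContinuous φ)
    (huncollapsed : ∃ r : ℝ, 0 < r ∧ ∃ δ : ℝ, 0 < δ ∧
      ∀ x y : X, ‖x - y‖ = r → δ ≤ ‖φ x - φ y‖) :
    ∃ (V : Type u) (_ : NormedAddCommGroup V) (_ : NormedSpace 𝕂 V),
      CompleteSpace V ∧
      FinitelyRepresentable 𝕂 V (Lp E 2 (volume.restrict (Set.Icc (0 : ℝ) 1))) ∧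
      ∃ f : X → V, IsUniformEmbedding f ∧ IsCoarseEmbedding f := by
  let : NormedSpace ℝ X := NormedSpace.restrictScalars ℝ 𝕜 X
  have : IsScalarTower ℝ 𝕜 X := IsScalarTower.of_algebraMap_smul fun _ _ => rfl
  let ρ' : G →* (X ≃ₗᵢ[ℝ] X) :=
    { toFun := fun g =>
        { (ρ g).toLinearEquiv.restrictScalars ℝ with norm_map' := (ρ g).norm_map }
      map_one' := by ext x; simp
      map_mul' := fun g h => by
        ext x
        change ρ (g * h) x = ρ g (ρ h x)
        rw [map_mul, LinearIsometryEquiv.coe_mul, Function.comp_apply] }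
  exact exists_embedding_of_real hG ρ' hρ hdense φ hφ huncollapsed
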